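/- Let $0\le\epsilon<\delta\le\tfrac12$ and let $W(y,z\mid x)$ be a two-user broadcast channel with binary input $X$ and binary outputs $Y$, $Z$ whose component channels $X\to Y$ and $X\to Z$ are binary symmetric channels with crossover probabilities $\epsilon$ and $\delta$, respectively. The Csiszár–Körner region $\mathcal R$ is the set of pairs $(R_e,R_c)$ of nonnegative reals (a secret rate and a common rate) for which there are random variables $U,V$ with finite alphabets such that $U\to V\to X\to (Y,Z)$ is a Markov chain, $(Y,Z)$ is the output of $W$ for the input $X$, and $$R_e\le I(V;Y\mid U)-I(V;Z\mid U),\qquad R_c\le\min\{I(U;Y),\,I(U;Z)\}.$$ Then $U$ may be taken ternary without loss of optimality, i.e. with an alphabet of three letters: 1. $\mathcal R$ does not change if $U$ is restricted to a three-letter alphabet. 2. $\mathcal R$ is also the set of pairs of nonnegative reals with $R_e\le I(X;Y\mid U)-I(X;Z\mid U)$ and $R_c\le I(U;Z)$ for some $U$ with $U\to X\to(Y,Z)$ a Markov chain, whether $U$ ranges over all finite alphabets or only over a three-letter alphabet. 3. For every $R_c$ for which $\mathcal R$ contains a pair $(R_e,R_c)$, the largest $R_e$ with $(R_e,R_c)\in\mathcal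 R$ exists and equals $I(X;Y\mid U)-I(X;Z\mid U)$ for some ternary $U$ with $U\to X\to(Y,Z)$ and $I(U;Z)\ge R_c$. 4. For every finite-valued $U$ with $U\to X\to(Y,Z)$ there is a ternary $U'$ with $U'\to X'\to(Y',Z')$, where $(Y',Z')$ is the output of $W$ for the input $X'$, such that $X'$ has the same distribution as $X$ and $I(U';Y')=I(U;Y)$, $I(U';Z')=I(U;Z)$, $I(X';Y'\mid U')=I(X;Y\mid U)$, $I(X';Z'\mid U')=I(X;Z\mid U)$. -/

import Mathlib

namespace SecretCommon

/-- Law (probability mass function) of a random variable `A` on a finite sample space `Ω`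
with probability weights `P`. -/
def law {Ω α : Type*} [Fintype Ω] [DecidableEq α] (P : Ω → ℝ) (A : Ω → α) (a : α) : ℝ :=
  ∑ ω, if A ω = a then P ω else 0

/-- Shannon entropy `H(A)`, in bits. -/
noncomputable def entropy {Ω α : Type*} [Fintype Ω] [Fintype α] [DecidableEq α]
    (P : Ω → ℝ) (A : Ω → α) : ℝ :=
  ∑ a, Real.negMulLog (law P A a) / Real.log 2

/-- Mutual information `I(A;B) = H(A) + H(B) - H(A,B)`, in bits. -/
noncomputable def mutualInfo {Ω α β : Type*} [Fintype Ω] [Fintype α] [DecidableEq α]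
    [Fintype β] [DecidableEq β] (P : Ω → ℝ) (A : Ω → α) (B : Ω → β) : ℝ :=
  entropy P A + entropy P B - entropy P (fun ω => (A ω, B ω))

/-- Conditional mutual information `I(A;B|C) = H(A,C) + H(B,C) - H(A,B,C) - H(C)`, in bits. -/
noncomputable def condMutualInfo {Ω α β γ : Type*} [Fintype Ω] [Fintype α] [DecidableEq α]
    [Fintype β] [DecidableEq β] [Fintype γ] [DecidableEq γ]
    (P : Ω → ℝ) (A : Ω → α) (B : Ω → β) (C : Ω → γ) : ℝ :=
  entropy P (fun ω => (A ω, C ω)) + entropy P (fun ω => (B ω, C ω))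
    - entropy P (fun ω => (A ω, B ω, C ω)) - entropy P C

/-- `A → B → C` is a Markov chain: `P(a,b,c) P(b) = P(a,b) P(b,c)` for all `a, b, c`. -/
def IsMarkovChain {Ω α β γ : Type*} [Fintype Ω] [DecidableEq α] [DecidableEq β] [DecidableEq γ]
    (P : Ω → ℝ) (A : Ω → α) (B : Ω → β) (C : Ω → γ) : Prop :=
  ∀ a b c, law P (fun ω => (A ω, B ω, C ω)) (a, b, c) * law P B b =
    law P (fun ω => (A ω, B ω)) (a, b) * law P (fun ω => (B ω, C ω)) (b, c)

/-- Transition probabilities of the binary symmetric channel with crossover probability `ε`. -/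
def bsc (ε : ℝ) (x y : Bool) : ℝ := if x = y then 1 - ε else ε

/-- `W x (y, z)` are the transition probabilities of a two-user broadcast channel whose two
components are binary symmetric, with crossover probabilities `ε` (first receiver) and `δ`
(second receiver). -/
structure IsBSCBroadcast (ε δ : ℝ) (W : Bool → Bool × Bool → ℝ) : Prop where
  prob : ∀ x, W x ∈ stdSimplex ℝ (Bool × Bool)
  fst : ∀ x y, ∑ z, W x (y, z) = bsc ε x y
  snd : ∀ x z, ∑ y, W x (y, z) = bsc δ x z

/-- `P` is a probability on `Ω`, `U → V → X → (Y, Z)` is a Markov chain under `P`, and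
`(Y, Z)` is the output of the broadcast channel `W` for the input `X`. -/
structure IsAdmissible {Ω α β : Type*} [Fintype Ω] [DecidableEq α] [DecidableEq β]
    (W : Bool → Bool × Bool → ℝ) (P : Ω → ℝ)
    (U : Ω → α) (V : Ω → β) (X Y Z : Ω → Bool) : Prop where
  prob : P ∈ stdSimplex ℝ Ω
  markov : IsMarkovChain P U V X
  channel : ∀ u v x y z,
    law P (fun ω => (U ω, V ω, X ω, Y ω, Z ω)) (u, v, x, y, z) =
      law P (fun ω => (U ω, V ω, X ω)) (u, v, x) * W x (y, z)

/-- Bound `I(V;Y|U) - I(V;Z|U)` on the secret rate. -/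
noncomputable def secretBound {Ω α β : Type*} [Fintype Ω] [Fintype α] [DecidableEq α]
    [Fintype β] [DecidableEq β] (P : Ω → ℝ) (U : Ω → α) (V : Ω → β) (Y Z : Ω → Bool) : ℝ :=
  condMutualInfo P V Y U - condMutualInfo P V Z U

/-- The Csiszár–Körner region of pairs `(R_e, R_c)` of a secret and a common rate, with the
auxiliary variable `U` restricted to an alphabet of `k` letters (and `V` in any finite alphabet):
`R_e ≤ I(V;Y|U) - I(V;Z|U)` and `R_c ≤ min (I(U;Y), I(U;Z))`. -/
def ckRegionOn (W : Bool → Bool × Bool → ℝ) (k : ℕ) : Set (ℝ × ℝ) :=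
  {R | 0 ≤ R.1 ∧ 0 ≤ R.2 ∧
    ∃ (Ω : Type) (_ : Fintype Ω) (P : Ω → ℝ) (n : ℕ) (U : Ω → Fin k) (V : Ω → Fin n)
      (X Y Z : Ω → Bool), IsAdmissible W P U V X Y Z ∧
        R.1 ≤ secretBound P U V Y Z ∧ R.2 ≤ min (mutualInfo P U Y) (mutualInfo P U Z)}

/-- The Csiszár–Körner region, with `U` in any finite alphabet. -/
def ckRegion (W : Bool → Bool × Bool → ℝ) : Set (ℝ × ℝ) := ⋃ k, ckRegionOn W k

/-- The region `R_e ≤ I(X;Y|U) - I(X;Z|U)`, `R_c ≤ I(U;Z)`, where `U → X → (Y, Z)` and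
`U` takes `k` values. -/
def simpleRegionOn (W : Bool → Bool × Bool → ℝ) (k : ℕ) : Set (ℝ × ℝ) :=
  {R | 0 ≤ R.1 ∧ 0 ≤ R.2 ∧
    ∃ (Ω : Type) (_ : Fintype Ω) (P : Ω → ℝ) (U : Ω → Fin k) (X Y Z : Ω → Bool),
      IsAdmissible W P U X X Y Z ∧
        R.1 ≤ secretBound P U X Y Z ∧ R.2 ≤ mutualInfo P U Z}

/-- The same region, with `U` in any finite alphabet. -/
def simpleRegion (W : Bool → Bool × Bool → ℝ) : Set (ℝ × ℝ) := ⋃ k, simpleRegionOn W k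

end SecretCommon

namespace SecretCommon

/-! Let `h_η(p)` be the output entropy of a binary symmetric channel with crossover `η` and input
bias `p`, and let `p_u` be the conditional probability of `X = true` given `U = u`. By the chain
rule, all the rates with `V = X` depend only on the mean of `p_U` and on the averages of `h_ε(p_U)`
and `h_δ(p_U)`. The triple of these numbers lies in the convex hull of the curve `t ↦ (t, h_ε t, h_δ
t)` in dimension three. The curve is connected, so Fenchel–Eggleston
(`exists_card_le_finrank_mem_convexHull`) represents the triple by three points of the curve, where
Carathéodory would need four; `exists_three_point` and `exists_ternary` turn them into a ternary
`U`.

The reduction to `V = X` and to the single constraint `I(U;Z)` rests on the convexity of `h_δ - h_ε`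
(`convexOn_outEntropy_sub`). Jensen gives `I(U;Z) ≤ I(U;Y)`, and the maximum at the endpoints, where
deterministic inputs live, makes `V = X` optimal. The largest secret rate is attained because
ternary laws form a compact set on which the rates are continuous. -/

/-! ### Convex hulls of connected sets -/

/-- A point that is a convex combination of at most `d` points is one of exactly `d`
(possibly repeated) points. -/
lemma exists_fin_convexCombination {E : Type*} [AddCommGroup E] [Module ℝ E] {d : ℕ}
    {T : Finset E} (hT : T.card ≤ d) {x : E} (hx : x ∈ convexHull ℝ (T : Set E)) :
    ∃ (w : Fin d → ℝ) (z : Fin d → E), (∀ k, 0 ≤ w k) ∧ ∑ k, w k = 1 ∧ (∀ k, z k ∈ T) ∧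
      ∑ k, w k • z k = x := by
  classical
  obtain ⟨w, hw, hw1, hwx⟩ := Finset.mem_convexHull'.1 hx
  have hne : Nonempty T := by
    by_contra h
    rw [not_nonempty_iff, Finset.isEmpty_coe_sort] at h
    simp [h] at hw1
  obtain ⟨e⟩ : Nonempty (T ↪ Fin d) :=
    Function.Embedding.nonempty_of_card_le (by simpa using hT)
  rw [← Finset.sum_coe_sort] at hw1 hwx
  -- Indices outside the range of `e` receive weight zero, so the arbitrary point that
  -- `Function.invFun` assigns to them is harmless.
  refine ⟨fun k => ∑ t : T, if e t = k then w t else 0, fun k => (Function.invFun e k : T),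
    fun k => Finset.sum_nonneg fun t _ => ?_, ?_, fun k => (Function.invFun e k).2, ?_⟩
  · split_ifs
    exacts [hw _ t.2, le_rfl]
  · rw [Finset.sum_comm]
    simpa using hw1
  · simp_rw [Finset.sum_smul]
    rw [Finset.sum_comm, ← hwx]
    refine Finset.sum_congr rfl fun t _ => ?_
    simp [ite_smul, Function.leftInverse_invFun e.injective t]

/-- **Fenchel–Eggleston.** In dimension `d`, every point of the convex hull of a connected set
is a convex combination of at most `d` points of the set. -/
theorem exists_card_le_finrank_mem_convexHull {E : Type*} [NormedAddCommGroup E]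
    [NormedSpace ℝ E] [FiniteDimensional ℝ E] (hE : 0 < Module.finrank ℝ E)
    {s : Set E} (hs : IsPreconnected s) {x : E} (hx : x ∈ convexHull ℝ s) :
    ∃ T : Finset E, (T : Set E) ⊆ s ∧ T.card ≤ Module.finrank ℝ E ∧
      x ∈ convexHull ℝ (T : Set E) := by
  classical
  obtain ⟨ι, _, z, w, hzs, hz, hw, hw1, hwx⟩ := eq_pos_convex_span_of_mem_convexHull hx
  have hcard : Fintype.card ι ≤ Module.finrank ℝ E + 1 :=
    hz.card_le_finrank_succ.trans (Nat.add_le_add_right (Submodule.finrank_le _) 1)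
  rcases hcard.lt_or_eq with hlt | heq
  · refine ⟨Finset.univ.image z, by simpa using hzs,
      Finset.card_image_le.trans (by simpa using Nat.lt_succ_iff.1 hlt), ?_⟩
    rw [← hwx]
    exact (convex_convexHull ℝ _).sum_mem (fun i _ => (hw i).le) hw1
      fun i _ => subset_convexHull ℝ _ (by simp)
  let b : AffineBasis ι ℝ E :=
    ⟨z, hz, hz.affineSpan_eq_top_iff_card_eq_finrank_add_one.2 heq⟩
  have hbz : ∀ i, b i = z i := fun _ => rfl
  -- In the full-dimensional case, `x` has barycentric coordinates `w`. The index maximizing `r i y`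
  -- is the first whose coordinate in `x - t • y` reaches zero as `t` grows. A tie at some `y ∈ s`
  -- makes two vertices drop out at once.
  let r : ι → E → ℝ := fun i y => b.coord i y / w i
  have hr : ∀ i, Continuous (r i) := fun i => (continuous_barycentric_coord b i).div_const _
  let F : ι → Set E := fun i => {y | ∀ j, r j y ≤ r i y}
  have hF : ∀ i, IsClosed (F i) := fun i => by
    simp only [F, Set.ofPred_forall]
    exact isClosed_iInter fun j => isClosed_le (hr j) (hr i)
  have hFz : ∀ i, z i ∈ F i := fun i j => by
    by_cases hij : j = i
    · rw [hij]
    · have h1 : r j (z i) = 0 := by simp [r, ← hbz, b.coord_apply_ne hij]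
      have h2 : r i (z i) = (w i)⁻¹ := by simp [r, ← hbz, b.coord_apply_eq]
      rw [h1, h2]
      exact (inv_pos.2 (hw i)).le
  have hne : Nonempty ι := Fintype.card_pos_iff.1 (by omega)
  have hFcover : ∀ y, ∃ i, y ∈ F i := fun y => by
    obtain ⟨i, -, hi⟩ := Finset.exists_max_image Finset.univ (fun i => r i y)
      Finset.univ_nonempty
    exact ⟨i, fun j => hi j (Finset.mem_univ j)⟩
  obtain ⟨i, i', hii'⟩ := Fintype.exists_pair_of_one_lt_card (α := ι) (by omega)
  -- The two closed sets cover `s`, and each meets `s` in a vertex; connectedness yields the tie.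
  obtain ⟨y, hys, hyi, hyj⟩ := isPreconnected_closed_iff.1 hs (F i) (⋃ j : {j // j ≠ i}, F j)
    (hF i) (isClosed_iUnion_of_finite fun j => hF j)
    (fun y _ => by
      obtain ⟨j, hj⟩ := hFcover y
      by_cases hji : j = i
      · exact Or.inl (hji ▸ hj)
      · exact Or.inr (Set.mem_iUnion.2 ⟨⟨j, hji⟩, hj⟩))
    ⟨z i, hzs ⟨i, rfl⟩, hFz i⟩
    ⟨z i', hzs ⟨i', rfl⟩, Set.mem_iUnion.2 ⟨⟨i', hii'.symm⟩, hFz i'⟩⟩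
  obtain ⟨⟨j, hji⟩, hyj⟩ := Set.mem_iUnion.1 hyj
  have hrij : r j y = r i y := le_antisymm (hyi j) (hyj i)
  have hmul : ∀ k, r k y * w k = b.coord k y := fun k => div_mul_cancel₀ _ (hw k).ne'
  have hpos : 0 < r i y := by
    by_contra! h
    have h0 : ∑ k, b.coord k y ≤ 0 := Finset.sum_nonpos fun k _ => by
      rw [← hmul]
      exact mul_nonpos_of_nonpos_of_nonneg ((hyi k).trans h) (hw k).le
    rw [b.sum_coord_apply_eq_one] at h0
    linarith
  -- This is the largest `t` for which all coordinates of `x - t • y` stay nonnegative; those at `i`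
  -- and `j` vanish.
  set t : ℝ := (r i y)⁻¹
  have htr : t * r i y = 1 := inv_mul_cancel₀ hpos.ne'
  let c : ι → ℝ := fun k => w k - t * b.coord k y
  have hc : ∀ k, c k = w k * (1 - t * r k y) := fun k => by simp only [c, ← hmul]; ring
  have hc0 : ∀ k, 0 ≤ c k := fun k => by
    rw [hc]
    refine mul_nonneg (hw k).le (sub_nonneg.2 ?_)
    rw [← htr]
    exact mul_le_mul_of_nonneg_left (hyi k) (inv_pos.2 hpos).le
  have hci : c i = 0 := by rw [hc, htr]; ring
  have hcj : c j = 0 := by rw [hc, hrij, htr]; ring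
  let S : Finset ι := (Finset.univ.erase i).erase j
  refine ⟨insert y (S.image z), ?_, ?_, ?_⟩
  · intro v hv
    rcases Finset.mem_insert.1 (Finset.mem_coe.1 hv) with rfl | hv
    · exact hys
    · obtain ⟨k, -, rfl⟩ := Finset.mem_image.1 hv
      exact hzs ⟨k, rfl⟩
  · have hS : S.card = Fintype.card ι - 1 - 1 := by
      rw [Finset.card_erase_of_mem (by simp [hji]), Finset.card_erase_of_mem (by simp),
        Finset.card_univ]
    have := Finset.card_insert_le y (S.image z)
    have := Finset.card_image_le (s := S) (f := z)
    omega
  · have hcw : ∑ k ∈ S, c k = 1 - t := by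
      rw [Finset.sum_erase _ hcj, Finset.sum_erase _ hci, Finset.sum_sub_distrib, hw1, ← Finset.mul_sum,
        b.sum_coord_apply_eq_one, mul_one]
    have hcz : ∑ k ∈ S, c k • z k = x - t • y := by
      rw [Finset.sum_erase _ (by simp [hcj]), Finset.sum_erase _ (by simp [hci])]
      simp only [c, sub_smul, Finset.sum_sub_distrib, hwx, mul_smul, ← Finset.smul_sum]
      congr 2
      exact b.linear_combination_coord_eq_self y
    -- The index `none` carries `y` with weight `t`; the remaining vertices carry the weights `c`,
    -- of total `1 - t`.
    have hmem := (convex_convexHull ℝ ((insert y (S.image z) : Finset E) : Set E)).sum_mem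
      (t := Finset.insertNone S) (w := fun o => o.elim t c) (z := fun o => o.elim y z)
      (by
        rintro (_ | k) _
        exacts [(inv_pos.2 hpos).le, hc0 k])
      (by simp [Finset.sum_insertNone, hcw])
      (by
        rintro (_ | k) hk
        · exact subset_convexHull ℝ _ (by simp)
        · exact subset_convexHull ℝ _ (by
            simpa using Or.inr ⟨k, by simpa using hk, rfl⟩))
    simpa [Finset.sum_insertNone, hcz] using hmem

/-! ### Output entropy of the binary symmetric channel -/

/-- Probability that the output of the binary symmetric channel is `true`, if the input is
`true` with probability `p`. -/
def bscOut (ε p : ℝ) : ℝ := p * (1 - ε) + (1 - p) * ε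

/-- Entropy, in bits, of the output of the binary symmetric channel. -/
noncomputable def outEntropy (ε p : ℝ) : ℝ := Real.binEntropy (bscOut ε p) / Real.log 2

lemma continuous_outEntropy (ε : ℝ) : Continuous (outEntropy ε) := by
  unfold outEntropy bscOut
  fun_prop

lemma outEntropy_one (ε : ℝ) : outEntropy ε 1 = outEntropy ε 0 := by
  simp [outEntropy, bscOut]

lemma bscOut_mem_Ioo {ε p : ℝ} (hε : 0 ≤ ε) (hε' : ε ≤ 1 / 2) (hp : p ∈ Set.Ioo (0 : ℝ) 1) :
    bscOut ε p ∈ Set.Ioo (0 : ℝ) 1 := by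
  obtain ⟨h0, h1⟩ := hp
  constructor <;> unfold bscOut
  · nlinarith [mul_pos h0 (show 0 < 1 - ε by linarith), mul_nonneg (sub_nonneg.2 h1.le) hε]
  · nlinarith [mul_pos (sub_pos.2 h1) (show 0 < 1 - ε by linarith), mul_nonneg h0.le hε]

/-- The entropy difference of the outputs of the worse and the better channel is convex in the
input distribution. -/
lemma convexOn_outEntropy_sub {ε δ : ℝ} (hε : 0 ≤ ε) (hεδ : ε ≤ δ) (hδ : δ ≤ 1 / 2) :
    ConvexOn ℝ (Set.Icc 0 1) (fun p => outEntropy δ p - outEntropy ε p) := by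
  have hout : ∀ η p : ℝ, HasDerivAt (bscOut η) (1 - 2 * η) p := fun η p => by
    have h := ((hasDerivAt_id p).mul_const (1 - η)).add
      (((hasDerivAt_const p (1 : ℝ)).sub (hasDerivAt_id p)).mul_const η)
    exact h.congr_deriv (by ring)
  have h1 : ∀ {η : ℝ}, 0 ≤ η → η ≤ 1 / 2 → ∀ p ∈ Set.Ioo (0 : ℝ) 1,
      HasDerivAt (outEntropy η) ((Real.log (1 - bscOut η p) - Real.log (bscOut η p)) *
        (1 - 2 * η) / Real.log 2) p := fun {η} h0 h2 p hp => by
    have hb := bscOut_mem_Ioo h0 h2 hp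
    exact ((Real.hasDerivAt_binEntropy hb.1.ne' hb.2.ne).comp p (hout η p)).div_const _
  have h2 : ∀ {η : ℝ}, 0 ≤ η → η ≤ 1 / 2 → ∀ p ∈ Set.Ioo (0 : ℝ) 1,
      HasDerivAt (fun p => (Real.log (1 - bscOut η p) - Real.log (bscOut η p)) *
        (1 - 2 * η) / Real.log 2)
        (-((1 - 2 * η) ^ 2 / (bscOut η p * (1 - bscOut η p))) / Real.log 2) p :=
    fun {η} h0 h2 p hp => by
    have hb := bscOut_mem_Ioo h0 h2 hp
    have hb1 : 1 - bscOut η p ≠ 0 := (sub_pos.2 hb.2).ne'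
    have hd := (((((hout η p).const_sub 1).log hb1).sub ((hout η p).log hb.1.ne')).mul_const
      (1 - 2 * η)).div_const (Real.log 2)
    refine hd.congr_deriv ?_
    congr 1
    have := hb.1.ne'
    field_simp
    ring
  have hε' : ε ≤ 1 / 2 := hεδ.trans hδ
  have hδ' : 0 ≤ δ := hε.trans hεδ
  -- Derivatives are needed only in the interior; for a noiseless channel they blow up at the
  -- endpoints, where continuity suffices.
  refine convexOn_of_hasDerivWithinAt2_nonneg (convex_Icc 0 1)
    ((continuous_outEntropy δ).sub (continuous_outEntropy ε)).continuousOn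
    (f' := fun p => (Real.log (1 - bscOut δ p) - Real.log (bscOut δ p)) *
        (1 - 2 * δ) / Real.log 2 - (Real.log (1 - bscOut ε p) - Real.log (bscOut ε p)) *
        (1 - 2 * ε) / Real.log 2)
    (f'' := fun p => -((1 - 2 * δ) ^ 2 / (bscOut δ p * (1 - bscOut δ p))) / Real.log 2 -
      -((1 - 2 * ε) ^ 2 / (bscOut ε p * (1 - bscOut ε p))) / Real.log 2) ?_ ?_ ?_
  · intro p hp
    rw [interior_Icc] at hp
    exact ((h1 hδ' hδ p hp).sub (h1 hε hε' p hp)).hasDerivWithinAt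
  · intro p hp
    rw [interior_Icc] at hp
    exact ((h2 hδ' hδ p hp).sub (h2 hε hε' p hp)).hasDerivWithinAt
  · intro p hp
    rw [interior_Icc] at hp
    have ha := bscOut_mem_Ioo hε hε' hp
    have hb := bscOut_mem_Ioo hδ' hδ hp
    rw [← sub_div]
    refine div_nonneg ?_ (Real.log_nonneg one_le_two)
    -- With `a = (1 - 2η)²` and `s = (1 - 2p)²` each side is `4a / (1 - a s)`, increasing in `a`.
    -- After cross-multiplication the terms in `s` cancel.
    have key : (1 - 2 * δ) ^ 2 / (bscOut δ p * (1 - bscOut δ p)) ≤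
        (1 - 2 * ε) ^ 2 / (bscOut ε p * (1 - bscOut ε p)) := by
      rw [div_le_div_iff₀ (mul_pos hb.1 (sub_pos.2 hb.2)) (mul_pos ha.1 (sub_pos.2 ha.2))]
      have hsq : (1 - 2 * δ) ^ 2 ≤ (1 - 2 * ε) ^ 2 := by
        apply pow_le_pow_left₀ <;> linarith
      have e : ∀ η, bscOut η p * (1 - bscOut η p) =
          (1 - (1 - 2 * η) ^ 2 * (1 - 2 * p) ^ 2) / 4 := fun η => by unfold bscOut; ring
      rw [e, e]
      linarith
    linarith

/-! ### Laws, conditional averages and the chain rule -/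

section Law

variable {Ω α β γ : Type*} [Fintype Ω] [DecidableEq α] [DecidableEq β] [DecidableEq γ]
  {P : Ω → ℝ}

lemma law_nonneg (hP : P ∈ stdSimplex ℝ Ω) (A : Ω → α) (a : α) : 0 ≤ law P A a :=
  Finset.sum_nonneg fun ω _ => by
    split_ifs
    exacts [hP.1 ω, le_rfl]

lemma sum_law [Fintype α] (hP : P ∈ stdSimplex ℝ Ω) (A : Ω → α) : ∑ a, law P A a = 1 := by
  unfold law
  rw [Finset.sum_comm]
  simpa using hP.2

lemma law_congr {A : Ω → α} {B : Ω → β} {a : α} {b : β} (h : ∀ ω, A ω = a ↔ B ω = b) :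
    law P A a = law P B b := by
  unfold law
  simp only [h]

lemma law_eq_zero {A : Ω → α} {a : α} (h : ∀ ω, A ω ≠ a) : law P A a = 0 := by
  simp [law, h]

/-- Marginalization: the law of `C` is obtained from the finer law of `A` by summing over the
values `g b` that correspond to `C = c`. -/
lemma law_eq_sum [Fintype β] {A : Ω → α} {B : Ω → β} {C : Ω → γ} {c : γ} (g : β → α)
    (h : ∀ ω b, A ω = g b ↔ C ω = c ∧ B ω = b) :
    law P C c = ∑ b, law P A (g b) := by
  unfold law
  rw [Finset.sum_comm]
  refine Finset.sum_congr rfl fun ω _ => ?_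
  simp only [h]
  by_cases hc : C ω = c <;> simp [hc]

lemma law_fst [Fintype β] (A : Ω → α) (B : Ω → β) (a : α) :
    law P A a = ∑ b, law P (fun ω => (A ω, B ω)) (a, b) :=
  law_eq_sum (B := B) (fun b => (a, b)) fun ω b => by simp

lemma law_snd [Fintype α] (A : Ω → α) (B : Ω → β) (b : β) :
    law P B b = ∑ a, law P (fun ω => (A ω, B ω)) (a, b) :=
  law_eq_sum (B := A) (fun a => (a, b)) fun ω a => by simp [and_comm]

lemma entropy_comp_equiv [Fintype α] [Fintype β] (e : α ≃ β) {A : Ω → α} {B : Ω → β}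
    (h : ∀ ω, B ω = e (A ω)) : entropy P B = entropy P A := by
  unfold entropy
  rw [← e.sum_comp]
  refine Finset.sum_congr rfl fun a _ => ?_
  rw [law_congr (A := B) (B := A) (b := a) fun ω => by simp [h]]

/-- Conditional probability of `X = true` given `A = a`. -/
noncomputable def condProb (P : Ω → ℝ) (A : Ω → α) (X : Ω → Bool) (a : α) : ℝ :=
  law P (fun ω => (A ω, X ω)) (a, true) / law P A a

/-- The average of `f (Pr (X = true | A))`. -/
noncomputable def condAvg [Fintype α] (P : Ω → ℝ) (A : Ω → α) (X : Ω → Bool) (f : ℝ → ℝ) : ℝ :=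
  ∑ a, law P A a * f (condProb P A X a)

lemma law_add_law (A : Ω → α) (X : Ω → Bool) (a : α) :
    law P (fun ω => (A ω, X ω)) (a, true) + law P (fun ω => (A ω, X ω)) (a, false) =
      law P A a := by
  rw [law_fst A X a]
  simp

lemma law_mul_condProb (hP : P ∈ stdSimplex ℝ Ω) (A : Ω → α) (X : Ω → Bool) (a : α) :
    law P A a * condProb P A X a = law P (fun ω => (A ω, X ω)) (a, true) := by
  -- On a null event the quotient is zero by convention, and the joint probability vanishes too,
  -- being one of two nonnegative terms with sum zero.
  by_cases h : law P A a = 0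
  · have h1 := law_nonneg hP (fun ω => (A ω, X ω)) (a, true)
    have h2 := law_nonneg hP (fun ω => (A ω, X ω)) (a, false)
    have h3 := law_add_law (P := P) A X a
    rw [h, zero_mul]
    linarith
  · rw [condProb, mul_div_cancel₀ _ h]

lemma condProb_mem_Icc (hP : P ∈ stdSimplex ℝ Ω) (A : Ω → α) (X : Ω → Bool) (a : α) :
    condProb P A X a ∈ Set.Icc (0 : ℝ) 1 := by
  have h2 := law_nonneg hP (fun ω => (A ω, X ω)) (a, false)
  have h3 := law_add_law (P := P) A X a
  exact ⟨div_nonneg (law_nonneg hP _ _) (law_nonneg hP _ _),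
    div_le_one_of_le₀ (by linarith) (law_nonneg hP _ _)⟩

lemma sum_law_mul_condProb [Fintype α] (hP : P ∈ stdSimplex ℝ Ω) (A : Ω → α) (X : Ω → Bool) :
    ∑ a, law P A a * condProb P A X a = law P X true := by
  simp_rw [law_mul_condProb hP]
  exact (law_snd A X true).symm

/-- Jensen's inequality for `condAvg`. -/
lemma le_condAvg [Fintype α] (hP : P ∈ stdSimplex ℝ Ω) (A : Ω → α) (X : Ω → Bool) {f : ℝ → ℝ}
    (hf : ConvexOn ℝ (Set.Icc 0 1) f) : f (law P X true) ≤ condAvg P A X f := by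
  have h := hf.map_sum_le (t := Finset.univ) (w := law P A) (p := condProb P A X)
    (fun a _ => law_nonneg hP A a) (sum_law hP A) (fun a _ => condProb_mem_Icc hP A X a)
  simp only [smul_eq_mul, sum_law_mul_condProb hP] at h
  exact h

lemma condAvg_le [Fintype α] (hP : P ∈ stdSimplex ℝ Ω) (A : Ω → α) (X : Ω → Bool) {f : ℝ → ℝ}
    {c : ℝ} (hf : ∀ p ∈ Set.Icc (0 : ℝ) 1, f p ≤ c) : condAvg P A X f ≤ c := by
  calc condAvg P A X f ≤ ∑ a, law P A a * c := Finset.sum_le_sum fun a _ =>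
        mul_le_mul_of_nonneg_left (hf _ (condProb_mem_Icc hP A X a)) (law_nonneg hP A a)
    _ = c := by rw [← Finset.sum_mul, sum_law hP, one_mul]

lemma condAvg_sub [Fintype α] (A : Ω → α) (X : Ω → Bool) (f g : ℝ → ℝ) :
    condAvg P A X (fun p => f p - g p) = condAvg P A X f - condAvg P A X g := by
  simp [condAvg, mul_sub]

/-- `Y` is the output of the binary symmetric channel with input `X`, also given `A`. -/
def IsBSCOutput (ε : ℝ) (P : Ω → ℝ) (A : Ω → α) (X Y : Ω → Bool) : Prop :=
  ∀ a y, law P (fun ω => (A ω, Y ω)) (a, y) =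
    ∑ x, law P (fun ω => (A ω, X ω)) (a, x) * bsc ε x y

/-- The chain rule `H(A,Y) = H(A) + H(Y|A)` for the output `Y` of a binary symmetric channel. -/
lemma IsBSCOutput.entropy_eq [Fintype α] {ε : ℝ} {A : Ω → α} {X Y : Ω → Bool}
    (h : IsBSCOutput ε P A X Y) (hP : P ∈ stdSimplex ℝ Ω) :
    entropy P (fun ω => (A ω, Y ω)) = entropy P A + condAvg P A X (outEntropy ε) := by
  unfold entropy condAvg
  rw [Fintype.sum_prod_type, ← Finset.sum_add_distrib]
  refine Finset.sum_congr rfl fun a _ => ?_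
  have h1 := law_mul_condProb hP A X a
  have h2 := law_add_law (P := P) A X a
  set t := law P A a
  set p := condProb P A X a
  have ht : law P (fun ω => (A ω, Y ω)) (a, true) = t * bscOut ε p := by
    rw [h]
    simp [bsc, bscOut]
    rw [← h1] at h2 ⊢
    linear_combination ε * h2
  have hf : law P (fun ω => (A ω, Y ω)) (a, false) = t * (1 - bscOut ε p) := by
    rw [h]
    simp [bsc, bscOut]
    rw [← h1] at h2 ⊢
    linear_combination (1 - ε) * h2
  rw [Fintype.sum_bool, ht, hf, Real.negMulLog_mul, Real.negMulLog_mul, outEntropy,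
    Real.binEntropy_eq_negMulLog_add_negMulLog_one_sub]
  ring

end Law

/-! ### Information quantities of admissible variables -/

section Admissible

variable {Ω α β : Type*} [Fintype Ω] [DecidableEq α] [DecidableEq β]
  {W : Bool → Bool × Bool → ℝ} {ε δ : ℝ} {P : Ω → ℝ} {U : Ω → α} {V : Ω → β} {X Y Z : Ω → Bool}

/-- When `V = X` the Markov condition is automatic, and events giving the two copies of `X`
different values are null. -/
lemma IsAdmissible.of_channel (hP : P ∈ stdSimplex ℝ Ω)
    (h : ∀ u x y z, law P (fun ω => (U ω, X ω, Y ω, Z ω)) (u, x, y, z) =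
      law P (fun ω => (U ω, X ω)) (u, x) * W x (y, z)) :
    IsAdmissible W P U X X Y Z where
  prob := hP
  markov a b c := by
    by_cases hbc : b = c
    · subst hbc
      rw [law_congr (A := fun ω => (U ω, X ω, X ω)) (B := fun ω => (U ω, X ω)) (b := (a, b))
          (fun ω => by simp),
        law_congr (A := fun ω => (X ω, X ω)) (B := X) (b := b) (fun ω => by simp)]
    · rw [law_eq_zero (A := fun ω => (U ω, X ω, X ω)), law_eq_zero (A := fun ω => (X ω, X ω))]
      · simp
      · rintro ω hω
        simp only [Prod.mk.injEq] at hω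
        exact hbc (hω.1.symm.trans hω.2)
      · rintro ω hω
        simp only [Prod.mk.injEq] at hω
        exact hbc (hω.2.1.symm.trans hω.2.2)
  channel u x' x y z := by
    by_cases hx : x' = x
    · subst hx
      rw [law_congr (A := fun ω => (U ω, X ω, X ω, Y ω, Z ω))
          (B := fun ω => (U ω, X ω, Y ω, Z ω)) (b := (u, x', y, z)) (fun ω => by simp),
        law_congr (A := fun ω => (U ω, X ω, X ω)) (B := fun ω => (U ω, X ω)) (b := (u, x'))
          (fun ω => by simp)]
      exact h u x' y z
    · rw [law_eq_zero, law_eq_zero, zero_mul]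
      · rintro ω hω
        simp only [Prod.mk.injEq] at hω
        exact hx (hω.2.1.symm.trans hω.2.2)
      · rintro ω hω
        simp only [Prod.mk.injEq] at hω
        exact hx (hω.2.1.symm.trans hω.2.2.1)

/-- The auxiliary variable `V` may be replaced by the channel input. -/
lemma IsAdmissible.input [Fintype β] (h : IsAdmissible W P U V X Y Z) :
    IsAdmissible W P U X X Y Z :=
  .of_channel h.prob fun u x y z => by
    rw [law_eq_sum (A := fun ω => (U ω, V ω, X ω, Y ω, Z ω)) (B := V)
        (C := fun ω => (U ω, X ω, Y ω, Z ω)) (fun v => (u, v, x, y, z))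
        (fun ω v => by simp only [Prod.mk.injEq]; tauto),
      law_eq_sum (A := fun ω => (U ω, V ω, X ω)) (B := V)
        (C := fun ω => (U ω, X ω)) (fun v => (u, v, x))
        (fun ω v => by simp only [Prod.mk.injEq]; tauto), Finset.sum_mul]
    exact Finset.sum_congr rfl fun v _ => h.channel u v x y z

/-- Admissibility is preserved by renaming the values of `V`. -/
lemma IsAdmissible.relabel {γ : Type*} [DecidableEq γ] (h : IsAdmissible W P U V X Y Z)
    (e : β ≃ γ) : IsAdmissible W P U (fun ω => e (V ω)) X Y Z where
  prob := h.prob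
  markov a b c := by
    obtain ⟨b, rfl⟩ := e.surjective b
    have := h.markov a b c
    rw [law_congr (A := V) (B := fun ω => e (V ω)) (b := e b) (fun ω => by simp),
      law_congr (A := fun ω => (U ω, V ω)) (B := fun ω => (U ω, e (V ω))) (b := (a, e b))
        (fun ω => by simp),
      law_congr (A := fun ω => (V ω, X ω)) (B := fun ω => (e (V ω), X ω)) (b := (e b, c))
        (fun ω => by simp),
      law_congr (A := fun ω => (U ω, V ω, X ω)) (B := fun ω => (U ω, e (V ω), X ω))
        (b := (a, e b, c)) (fun ω => by simp)] at this
    exact this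
  channel u v x y z := by
    obtain ⟨v, rfl⟩ := e.surjective v
    have := h.channel u v x y z
    rw [law_congr (A := fun ω => (U ω, V ω, X ω)) (B := fun ω => (U ω, e (V ω), X ω))
        (b := (u, e v, x)) (fun ω => by simp),
      law_congr (A := fun ω => (U ω, V ω, X ω, Y ω, Z ω))
        (B := fun ω => (U ω, e (V ω), X ω, Y ω, Z ω))
        (b := (u, e v, x, y, z)) (fun ω => by simp)] at this
    exact this

/-- Summing over the other output leaves only a marginal of `W`, so the correlation between the two
outputs does not affect the rates. -/
lemma IsAdmissible.isBSCOutput_pair_fst (h : IsAdmissible W P U V X Y Z)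
    (hW : IsBSCBroadcast ε δ W) : IsBSCOutput ε P (fun ω => (V ω, U ω)) X Y := by
  rintro ⟨v, u⟩ y
  rw [law_eq_sum (A := fun ω => (U ω, V ω, X ω, Y ω, Z ω)) (B := fun ω => (X ω, Z ω))
      (fun b => (u, v, b.1, y, b.2))
      (fun ω b => by simp only [Prod.ext_iff]; tauto), Fintype.sum_prod_type]
  refine Finset.sum_congr rfl fun x _ => ?_
  simp only [h.channel, ← Finset.mul_sum, hW.fst]
  rw [law_congr (B := fun ω => ((V ω, U ω), X ω)) (b := ((v, u), x))
    (fun ω => by simp only [Prod.mk.injEq]; tauto)]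

lemma IsAdmissible.isBSCOutput_pair_snd (h : IsAdmissible W P U V X Y Z)
    (hW : IsBSCBroadcast ε δ W) : IsBSCOutput δ P (fun ω => (V ω, U ω)) X Z := by
  rintro ⟨v, u⟩ z
  rw [law_eq_sum (A := fun ω => (U ω, V ω, X ω, Y ω, Z ω)) (B := fun ω => (X ω, Y ω))
      (fun b => (u, v, b.1, b.2, z))
      (fun ω b => by simp only [Prod.ext_iff]; tauto), Fintype.sum_prod_type]
  refine Finset.sum_congr rfl fun x _ => ?_
  simp only [h.channel, ← Finset.mul_sum, hW.snd]
  rw [law_congr (B := fun ω => ((V ω, U ω), X ω)) (b := ((v, u), x))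
    (fun ω => by simp only [Prod.mk.injEq]; tauto)]

/-- Forgetting part of the conditioning variable. -/
lemma IsBSCOutput.of_pair [Fintype β] (h : IsBSCOutput ε P (fun ω => (V ω, U ω)) X Y) :
    IsBSCOutput ε P U X Y := by
  intro u y
  rw [law_eq_sum (A := fun ω => ((V ω, U ω), Y ω)) (B := V) (fun v => ((v, u), y))
    (fun ω b => by simp only [Prod.mk.injEq]; tauto)]
  simp_rw [h _ _]
  rw [Finset.sum_comm]
  refine Finset.sum_congr rfl fun x _ => ?_
  rw [← Finset.sum_mul, law_eq_sum (A := fun ω => ((V ω, U ω), X ω)) (B := V)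
    (C := fun ω => (U ω, X ω)) (fun v => ((v, u), x))
    (fun ω b => by simp only [Prod.mk.injEq]; tauto)]

lemma IsBSCOutput.entropy_output [Fintype α] (h : IsBSCOutput ε P U X Y)
    (hP : P ∈ stdSimplex ℝ Ω) : entropy P Y = outEntropy ε (law P X true) := by
  -- Conditioning on a constant turns the chain rule into the unconditional formula.
  have h' : IsBSCOutput ε P (fun _ : Ω => ()) X Y := by
    refine IsBSCOutput.of_pair (V := U) fun a y => ?_
    have := h a.1 y
    rw [law_congr (A := fun ω => ((U ω, ()), Y ω)) (B := fun ω => (U ω, Y ω)) (b := (a.1, y))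
      (fun ω => by simp [Prod.ext_iff]), this]
    refine Finset.sum_congr rfl fun x _ => ?_
    rw [law_congr (A := fun ω => ((U ω, ()), X ω)) (B := fun ω => (U ω, X ω)) (b := (a.1, x))
      (fun ω => by simp [Prod.ext_iff])]
  have he := h'.entropy_eq hP
  have hone : law P (fun _ : Ω => ()) () = 1 := by
    simpa using sum_law hP (fun _ : Ω => ())
  rw [entropy_comp_equiv (Equiv.punitProd Bool).symm (A := Y) (B := fun ω => ((), Y ω))
    (fun ω => rfl)] at he
  rw [he]
  have hX := sum_law_mul_condProb hP (fun _ : Ω => ()) X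
  simp only [Finset.univ_unique, Finset.sum_singleton, PUnit.default_eq_unit, hone,
    one_mul] at hX
  simp [entropy, condAvg, hone, hX]

lemma IsBSCOutput.mutualInfo_eq [Fintype α] (h : IsBSCOutput ε P U X Y)
    (hP : P ∈ stdSimplex ℝ Ω) :
    mutualInfo P U Y = outEntropy ε (law P X true) - condAvg P U X (outEntropy ε) := by
  rw [mutualInfo, h.entropy_eq hP, h.entropy_output hP]
  ring

lemma IsBSCOutput.condMutualInfo_eq [Fintype α] [Fintype β]
    (h : IsBSCOutput ε P (fun ω => (V ω, U ω)) X Y) (hP : P ∈ stdSimplex ℝ Ω) :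
    condMutualInfo P V Y U = condAvg P U X (outEntropy ε) -
      condAvg P (fun ω => (V ω, U ω)) X (outEntropy ε) := by
  have h1 : entropy P (fun ω => (Y ω, U ω)) = entropy P (fun ω => (U ω, Y ω)) :=
    entropy_comp_equiv (Equiv.prodComm _ _) fun ω => rfl
  have h2 : entropy P (fun ω => (V ω, Y ω, U ω)) = entropy P (fun ω => ((V ω, U ω), Y ω)) :=
    entropy_comp_equiv ((Equiv.prodAssoc _ _ _).trans
      ((Equiv.refl _).prodCongr (Equiv.prodComm _ _))) fun ω => rfl
  rw [condMutualInfo, h1, h2, h.entropy_eq hP, h.of_pair.entropy_eq hP]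
  ring

/-- Given `X` itself, the output entropy is that for a deterministic input. -/
lemma condAvg_input [Fintype α] (hP : P ∈ stdSimplex ℝ Ω) (U : Ω → α) (X : Ω → Bool)
    (f : ℝ → ℝ) (hf : f 1 = f 0) : condAvg P (fun ω => (X ω, U ω)) X f = f 0 := by
  have key : ∀ a, law P (fun ω => (X ω, U ω)) a *
      f (condProb P (fun ω => (X ω, U ω)) X a) = law P (fun ω => (X ω, U ω)) a * f 0 := by
    rintro ⟨x, u⟩
    by_cases h0 : law P (fun ω => (X ω, U ω)) (x, u) = 0
    · rw [h0, zero_mul, zero_mul]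
    congr 1
    cases x
    · rw [condProb, law_eq_zero, zero_div]
      rintro ω hω
      simp only [Prod.mk.injEq] at hω
      simp [hω.1.1] at hω
    · rw [condProb, law_congr (B := fun ω => (X ω, U ω)) (b := (true, u)), div_self h0, hf]
      intro ω
      simp only [Prod.mk.injEq]
      tauto
  rw [condAvg, Finset.sum_congr rfl fun a _ => key a, ← Finset.sum_mul, sum_law hP, one_mul]

variable [Fintype α]

lemma IsAdmissible.mutualInfo_fst [Fintype β] (h : IsAdmissible W P U V X Y Z)
    (hW : IsBSCBroadcast ε δ W) :
    mutualInfo P U Y = outEntropy ε (law P X true) - condAvg P U X (outEntropy ε) :=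
  (h.isBSCOutput_pair_fst hW).of_pair.mutualInfo_eq h.prob

lemma IsAdmissible.mutualInfo_snd [Fintype β] (h : IsAdmissible W P U V X Y Z)
    (hW : IsBSCBroadcast ε δ W) :
    mutualInfo P U Z = outEntropy δ (law P X true) - condAvg P U X (outEntropy δ) :=
  (h.isBSCOutput_pair_snd hW).of_pair.mutualInfo_eq h.prob

lemma IsAdmissible.condMutualInfo_fst (h : IsAdmissible W P U X X Y Z)
    (hW : IsBSCBroadcast ε δ W) :
    condMutualInfo P X Y U = condAvg P U X (outEntropy ε) - outEntropy ε 0 := by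
  rw [(h.isBSCOutput_pair_fst hW).condMutualInfo_eq h.prob,
    condAvg_input h.prob U X _ (outEntropy_one ε)]

lemma IsAdmissible.condMutualInfo_snd (h : IsAdmissible W P U X X Y Z)
    (hW : IsBSCBroadcast ε δ W) :
    condMutualInfo P X Z U = condAvg P U X (outEntropy δ) - outEntropy δ 0 := by
  rw [(h.isBSCOutput_pair_snd hW).condMutualInfo_eq h.prob,
    condAvg_input h.prob U X _ (outEntropy_one δ)]

/-- The better receiver knows at least as much about `U`. -/
lemma IsAdmissible.mutualInfo_le [Fintype β] (h : IsAdmissible W P U V X Y Z)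
    (hW : IsBSCBroadcast ε δ W) (hε : 0 ≤ ε) (hεδ : ε ≤ δ) (hδ : δ ≤ 1 / 2) :
    mutualInfo P U Z ≤ mutualInfo P U Y := by
  -- `I(U;Y) - I(U;Z)` is exactly the Jensen gap of the convex function `h_δ - h_ε`.
  have hJ := le_condAvg h.prob U X (convexOn_outEntropy_sub hε hεδ hδ)
  rw [condAvg_sub] at hJ
  rw [h.mutualInfo_fst hW, h.mutualInfo_snd hW]
  linarith

/-- The secret rate bound is largest for `V = X`. -/
lemma IsAdmissible.secretBound_le [Fintype β] (h : IsAdmissible W P U V X Y Z)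
    (hW : IsBSCBroadcast ε δ W) (hε : 0 ≤ ε) (hεδ : ε ≤ δ) (hδ : δ ≤ 1 / 2) :
    secretBound P U V Y Z ≤ secretBound P U X Y Z := by
  have hconv := convexOn_outEntropy_sub hε hεδ hδ
  -- `V` enters the bound only through the average of `h_δ - h_ε` given `(V, U)`. This convex
  -- function takes the same value at `0` and `1`, which is its maximum and is the average obtained
  -- for `V = X`.
  have hle := condAvg_le h.prob (fun ω => (V ω, U ω)) X
    (f := fun p => outEntropy δ p - outEntropy ε p) (c := outEntropy δ 0 - outEntropy ε 0)
    (fun p hp => by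
      have := hconv.le_max_of_mem_Icc (x := 0) (y := 1) (by simp) (by simp) hp
      simpa [outEntropy_one] using this)
  rw [condAvg_sub] at hle
  rw [secretBound, secretBound, h.input.condMutualInfo_fst hW, h.input.condMutualInfo_snd hW,
    (h.isBSCOutput_pair_fst hW).condMutualInfo_eq h.prob,
    (h.isBSCOutput_pair_snd hW).condMutualInfo_eq h.prob]
  linarith

end Admissible

/-! ### Realizing prescribed weights and conditional probabilities -/

section Model

variable {k : ℕ} {W : Bool → Bool × Bool → ℝ} {w p : Fin k → ℝ}

/-- Joint law of `(U, X, Y, Z)` if `U` has law `w`, `X = true` has conditional probability `p u`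
given `U = u`, and `(Y, Z)` is the output of `W` for the input `X`. -/
def jointLaw (W : Bool → Bool × Bool → ℝ) (w p : Fin k → ℝ) :
    Fin k × Bool × Bool × Bool → ℝ :=
  fun ω => w ω.1 * (if ω.2.1 then p ω.1 else 1 - p ω.1) * W ω.2.1 ω.2.2

lemma law_jointLaw_input (hW : ∀ x, W x ∈ stdSimplex ℝ (Bool × Bool)) (u : Fin k) (x : Bool) :
    law (jointLaw W w p) (fun ω => (ω.1, ω.2.1)) (u, x) = w u * (if x then p u else 1 - p u) := by
  rw [law_eq_sum (A := fun ω => ω) (B := fun ω => ω.2.2) (fun b => (u, x, b))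
    (fun ω b => by simp only [Prod.ext_iff]; tauto)]
  have : ∀ b, law (jointLaw W w p) (fun ω => ω) (u, x, b) =
      w u * (if x then p u else 1 - p u) * W x b := fun b => by
    simp [law, jointLaw]
  simp_rw [this]
  rw [← Finset.mul_sum, (hW x).2, mul_one]

lemma law_jointLaw_aux (hW : ∀ x, W x ∈ stdSimplex ℝ (Bool × Bool)) :
    law (jointLaw W w p) (fun ω => ω.1) = w := by
  funext u
  rw [law_fst (fun ω : Fin k × Bool × Bool × Bool => ω.1) (fun ω => ω.2.1), Fintype.sum_bool, law_jointLaw_input hW,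
    law_jointLaw_input hW]
  simp
  ring

lemma jointLaw_mem_stdSimplex (hW : ∀ x, W x ∈ stdSimplex ℝ (Bool × Bool))
    (hw : w ∈ stdSimplex ℝ (Fin k)) (hp : ∀ u, p u ∈ Set.Icc (0 : ℝ) 1) :
    jointLaw W w p ∈ stdSimplex ℝ (Fin k × Bool × Bool × Bool) := by
  refine ⟨fun ω => mul_nonneg (mul_nonneg (hw.1 _) ?_) ((hW _).1 _), ?_⟩
  · split_ifs
    exacts [(hp _).1, sub_nonneg.2 (hp _).2]
  · have h := hw.2
    rw [← law_jointLaw_aux (w := w) (p := p) hW] at h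
    unfold law at h
    rw [Finset.sum_comm] at h
    simpa using h

lemma isAdmissible_jointLaw (hW : ∀ x, W x ∈ stdSimplex ℝ (Bool × Bool))
    (hw : w ∈ stdSimplex ℝ (Fin k)) (hp : ∀ u, p u ∈ Set.Icc (0 : ℝ) 1) :
    IsAdmissible W (jointLaw W w p) (fun ω => ω.1) (fun ω => ω.2.1) (fun ω => ω.2.1)
      (fun ω => ω.2.2.1) (fun ω => ω.2.2.2) := by
  refine .of_channel (jointLaw_mem_stdSimplex hW hw hp) fun u x y z => ?_
  rw [law_jointLaw_input hW]
  simp [law, jointLaw]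

lemma condAvg_jointLaw (hW : ∀ x, W x ∈ stdSimplex ℝ (Bool × Bool)) (f : ℝ → ℝ) :
    condAvg (jointLaw W w p) (fun ω => ω.1) (fun ω => ω.2.1) f = ∑ u, w u * f (p u) := by
  refine Finset.sum_congr rfl fun u _ => ?_
  rw [condProb, law_jointLaw_input hW, law_jointLaw_aux hW]
  -- For a letter of weight zero the conditional probability defaults to `0` instead of `p u`, but
  -- the weight removes the term.
  by_cases h : w u = 0
  · simp [h]
  · rw [if_pos rfl, mul_div_cancel_left₀ _ h]

lemma law_jointLaw_true (hW : ∀ x, W x ∈ stdSimplex ℝ (Bool × Bool)) :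
    law (jointLaw W w p) (fun ω => ω.2.1) true = ∑ u, w u * p u := by
  rw [law_snd (fun ω => ω.1)]
  exact Finset.sum_congr rfl fun u _ => by rw [law_jointLaw_input hW, if_pos rfl]

end Model

/-! ### Reduction to three letters -/

/-- A finitely supported distribution on `[0, 1]` can be replaced by one on three points without
changing the mean and the averages of two continuous functions. -/
lemma exists_three_point {ι : Type*} [Fintype ι] {w p : ι → ℝ} (hw : w ∈ stdSimplex ℝ ι)
    (hp : ∀ i, p i ∈ Set.Icc (0 : ℝ) 1) {f g : ℝ → ℝ} (hf : Continuous f) (hg : Continuous g) :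
    ∃ w' ∈ stdSimplex ℝ (Fin 3), ∃ p' : Fin 3 → ℝ, (∀ u, p' u ∈ Set.Icc (0 : ℝ) 1) ∧
      ∑ u, w' u * p' u = ∑ i, w i * p i ∧ ∑ u, w' u * f (p' u) = ∑ i, w i * f (p i) ∧
      ∑ u, w' u * g (p' u) = ∑ i, w i * g (p i) := by
  -- Three moments are to be matched; the total mass is already part of being a convex combination.
  let c : ℝ → ℝ × ℝ × ℝ := fun t => (t, f t, g t)
  have hc : IsPreconnected (c '' Set.Icc 0 1) :=
    isPreconnected_Icc.image _ (by fun_prop)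
  have hx : ∑ i, w i • c (p i) ∈ convexHull ℝ (c '' Set.Icc 0 1) :=
    (convex_convexHull ℝ _).sum_mem (fun i _ => hw.1 i) hw.2
      fun i _ => subset_convexHull ℝ _ ⟨p i, hp i, rfl⟩
  have hdim : Module.finrank ℝ (ℝ × ℝ × ℝ) = 3 := by simp
  obtain ⟨T, hTs, hTcard, hxT⟩ :=
    exists_card_le_finrank_mem_convexHull (by rw [hdim]; norm_num) hc hx
  obtain ⟨w', z, hw', hw'1, hz, hsum⟩ := exists_fin_convexCombination (hTcard.trans_eq hdim) hxT
  choose p' hp' hcp using fun u => hTs (hz u)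
  simp_rw [← hcp] at hsum
  refine ⟨w', ⟨hw', hw'1⟩, p', hp', ?_, ?_, ?_⟩
  · simpa [c, Prod.fst_sum] using congrArg Prod.fst hsum
  · simpa [c, Prod.fst_sum, Prod.snd_sum] using congrArg (fun v => v.2.1) hsum
  · simpa [c, Prod.fst_sum, Prod.snd_sum] using congrArg (fun v => v.2.2) hsum

variable {W : Bool → Bool × Bool → ℝ} {ε δ : ℝ}

/-- The mean fixes the law of the binary input, hence the unconditional output entropies; the two
entropy averages fix the rest. -/
lemma exists_ternary (hW : IsBSCBroadcast ε δ W)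
    {Ω : Type*} [Fintype Ω] {P : Ω → ℝ} {k : ℕ} {U : Ω → Fin k} {X Y Z : Ω → Bool}
    (h : IsAdmissible W P U X X Y Z) :
    ∃ (Ω' : Type) (_ : Fintype Ω') (P' : Ω' → ℝ) (U' : Ω' → Fin 3) (X' Y' Z' : Ω' → Bool),
      IsAdmissible W P' U' X' X' Y' Z' ∧ law P' X' = law P X ∧
      mutualInfo P' U' Y' = mutualInfo P U Y ∧ mutualInfo P' U' Z' = mutualInfo P U Z ∧
      condMutualInfo P' X' Y' U' = condMutualInfo P X Y U ∧
      condMutualInfo P' X' Z' U' = condMutualInfo P X Z U := by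
  obtain ⟨w, hw, p, hp, hmean, hε, hδ⟩ := exists_three_point
    (w := law P U) (p := condProb P U X) ⟨law_nonneg h.prob U, sum_law h.prob U⟩
    (condProb_mem_Icc h.prob U X) (continuous_outEntropy ε) (continuous_outEntropy δ)
  rw [sum_law_mul_condProb h.prob] at hmean
  have h' := isAdmissible_jointLaw hW.prob hw hp
  have htrue := law_jointLaw_true (w := w) (p := p) hW.prob
  rw [hmean] at htrue
  have hlaw : law (jointLaw W w p) (fun ω => ω.2.1) = law P X := by
    funext x
    cases x
    · have h1 := sum_law h.prob X
      have h2 := sum_law h'.prob (fun ω => ω.2.1)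
      rw [Fintype.sum_bool] at h1 h2
      linarith
    · exact htrue
  refine ⟨_, inferInstance, jointLaw W w p, _, _, _, _, h', hlaw, ?_, ?_, ?_, ?_⟩
  · rw [h.mutualInfo_fst hW, h'.mutualInfo_fst hW, hlaw, condAvg_jointLaw hW.prob, hε, condAvg]
  · rw [h.mutualInfo_snd hW, h'.mutualInfo_snd hW, hlaw, condAvg_jointLaw hW.prob, hδ, condAvg]
  · rw [h.condMutualInfo_fst hW, h'.condMutualInfo_fst hW, condAvg_jointLaw hW.prob, hε, condAvg]
  · rw [h.condMutualInfo_snd hW, h'.condMutualInfo_snd hW, condAvg_jointLaw hW.prob, hδ, condAvg]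

/-! ### Equality of the rate regions -/

lemma simpleRegionOn_subset_three (hW : IsBSCBroadcast ε δ W) (k : ℕ) :
    simpleRegionOn W k ⊆ simpleRegionOn W 3 := by
  rintro R ⟨h1, h2, Ω, _, P, U, X, Y, Z, h, he, hc⟩
  obtain ⟨Ω', i', P', U', X', Y', Z', h', -, -, hZ, hXY, hXZ⟩ := exists_ternary hW h
  refine ⟨h1, h2, Ω', i', P', U', X', Y', Z', h', ?_, hZ ▸ hc⟩
  rw [secretBound, hXY, hXZ]
  exact he

/-- Only `V` changes, while `U` is kept, so the two forms agree for each alphabet size separately.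
-/
lemma ckRegionOn_eq_simpleRegionOn (hW : IsBSCBroadcast ε δ W) (hε : 0 ≤ ε) (hεδ : ε ≤ δ)
    (hδ : δ ≤ 1 / 2) (k : ℕ) : ckRegionOn W k = simpleRegionOn W k := by
  ext R
  constructor
  · rintro ⟨h1, h2, Ω, _, P, n, U, V, X, Y, Z, h, he, hc⟩
    exact ⟨h1, h2, Ω, _, P, U, X, Y, Z, h.input,
      he.trans (h.secretBound_le hW hε hεδ hδ), hc.trans (min_le_right _ _)⟩
  · rintro ⟨h1, h2, Ω, _, P, U, X, Y, Z, h, he, hc⟩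
    -- The region asks for `V` with values in some `Fin n`, so the Boolean input is renamed.
    let e : Bool ≃ Fin 2 := finTwoEquiv.symm
    have hV := h.relabel e
    have hY : condMutualInfo P (fun ω => e (X ω)) Y U = condMutualInfo P X Y U := by
      unfold condMutualInfo
      rw [entropy_comp_equiv (e.prodCongr (Equiv.refl _)) (A := fun ω => (X ω, U ω))
          (B := fun ω => (e (X ω), U ω)) (fun ω => rfl),
        entropy_comp_equiv (e.prodCongr (Equiv.refl _)) (A := fun ω => (X ω, Y ω, U ω))
          (B := fun ω => (e (X ω), Y ω, U ω)) (fun ω => rfl)]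
    have hZ : condMutualInfo P (fun ω => e (X ω)) Z U = condMutualInfo P X Z U := by
      unfold condMutualInfo
      rw [entropy_comp_equiv (e.prodCongr (Equiv.refl _)) (A := fun ω => (X ω, U ω))
          (B := fun ω => (e (X ω), U ω)) (fun ω => rfl),
        entropy_comp_equiv (e.prodCongr (Equiv.refl _)) (A := fun ω => (X ω, Z ω, U ω))
          (B := fun ω => (e (X ω), Z ω, U ω)) (fun ω => rfl)]
    refine ⟨h1, h2, Ω, _, P, 2, U, fun ω => e (X ω), X, Y, Z, hV, ?_,
      le_min (hc.trans (h.mutualInfo_le hW hε hεδ hδ)) hc⟩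
    rw [secretBound, hY, hZ]
    exact he

lemma simpleRegion_eq_three (hW : IsBSCBroadcast ε δ W) :
    simpleRegion W = simpleRegionOn W 3 :=
  (Set.iUnion_subset (simpleRegionOn_subset_three hW)).antisymm
    (Set.subset_iUnion (simpleRegionOn W) 3)

lemma ckRegion_eq_simpleRegion (hW : IsBSCBroadcast ε δ W) (hε : 0 ≤ ε) (hεδ : ε ≤ δ)
    (hδ : δ ≤ 1 / 2) : ckRegion W = simpleRegion W :=
  Set.iUnion_congr (ckRegionOn_eq_simpleRegionOn hW hε hεδ hδ)

/-! ### Attainment of the maximal secret rate -/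

/-- For a feasible common rate, the maximal secret rate with ternary `U` is attained. -/
lemma exists_isGreatest (hW : IsBSCBroadcast ε δ W) {Rc : ℝ}
    (hRc : ∃ Re, (Re, Rc) ∈ simpleRegionOn W 3) :
    ∃ (Ω : Type) (_ : Fintype Ω) (P : Ω → ℝ) (U : Ω → Fin 3) (X Y Z : Ω → Bool),
      IsAdmissible W P U X X Y Z ∧ Rc ≤ mutualInfo P U Z ∧
      IsGreatest {Re | (Re, Rc) ∈ simpleRegionOn W 3} (secretBound P U X Y Z) := by
  -- `K` parametrizes ternary `U` by weights and conditional input probabilities; `F` is `I(U;Z)`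
  -- and `S` the secret rate bound in these coordinates.
  let K : Set ((Fin 3 → ℝ) × (Fin 3 → ℝ)) :=
    stdSimplex ℝ (Fin 3) ×ˢ Set.univ.pi fun _ => Set.Icc (0 : ℝ) 1
  let F : (Fin 3 → ℝ) × (Fin 3 → ℝ) → ℝ := fun q =>
    outEntropy δ (∑ u, q.1 u * q.2 u) - ∑ u, q.1 u * outEntropy δ (q.2 u)
  let S : (Fin 3 → ℝ) × (Fin 3 → ℝ) → ℝ := fun q =>
    (∑ u, q.1 u * outEntropy ε (q.2 u) - outEntropy ε 0) -
      (∑ u, q.1 u * outEntropy δ (q.2 u) - outEntropy δ 0)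
  have hcε := continuous_outEntropy ε
  have hcδ := continuous_outEntropy δ
  have hF : Continuous F := by fun_prop
  have hS : Continuous S := by fun_prop
  have hK : IsCompact (K ∩ {q | Rc ≤ F q}) :=
    ((isCompact_stdSimplex ℝ (Fin 3)).prod (isCompact_univ_pi fun _ => isCompact_Icc)).inter_right
      (isClosed_le continuous_const hF)
  have hmem : ∀ {Re}, (Re, Rc) ∈ simpleRegionOn W 3 → ∃ q ∈ K ∩ {q | Rc ≤ F q}, Re ≤ S q := by
    rintro Re ⟨-, -, Ω, _, P, U, X, Y, Z, h, he, hc⟩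
    refine ⟨(law P U, condProb P U X),
      ⟨⟨⟨law_nonneg h.prob U, sum_law h.prob U⟩, fun u _ => condProb_mem_Icc h.prob U X u⟩,
        ?_⟩, ?_⟩
    · rw [h.mutualInfo_snd hW] at hc
      simpa only [F, condAvg, Set.mem_ofPred_eq, sum_law_mul_condProb h.prob] using hc
    · rw [secretBound, h.condMutualInfo_fst hW, h.condMutualInfo_snd hW] at he
      exact he
  obtain ⟨R₀, hR₀⟩ := hRc
  obtain ⟨q₀, hq₀, hR₀S⟩ := hmem hR₀
  obtain ⟨⟨w, p⟩, ⟨⟨hw, hp⟩, hq⟩, hmax⟩ := hK.exists_isMaxOn ⟨q₀, hq₀⟩ hS.continuousOn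
  have h := isAdmissible_jointLaw hW.prob hw fun u => hp u trivial
  have hI : Rc ≤ mutualInfo (jointLaw W w p) (fun ω => ω.1) (fun ω => ω.2.2.2) := by
    rw [h.mutualInfo_snd hW, law_jointLaw_true hW.prob, condAvg_jointLaw hW.prob]
    exact hq
  have hB : secretBound (jointLaw W w p) (fun ω => ω.1) (fun ω => ω.2.1) (fun ω => ω.2.2.1)
      (fun ω => ω.2.2.2) = S (w, p) := by
    rw [secretBound, h.condMutualInfo_fst hW, h.condMutualInfo_snd hW,
      condAvg_jointLaw hW.prob, condAvg_jointLaw hW.prob]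
  refine ⟨_, inferInstance, jointLaw W w p, _, _, _, _, h, hI, ?_, ?_⟩
  -- Membership requires a nonnegative maximum, which follows by comparison with the feasible rate
  -- `R₀`.
  · refine ⟨?_, hR₀.2.1, _, inferInstance, jointLaw W w p, _, _, _, _, h, le_rfl, hI⟩
    rw [hB]
    exact hR₀.1.trans (hR₀S.trans (hmax hq₀))
  · intro Re hRe
    obtain ⟨q, hq, hle⟩ := hmem hRe
    rw [hB]
    exact hle.trans (hmax hq)

end SecretCommon

theorem mainTheorem5 (ε δ : ℝ) (hε : 0 ≤ ε) (hεδ : ε < δ) (hδ : δ ≤ 1 / 2)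
    (W : Bool → Bool × Bool → ℝ) (hW : SecretCommon.IsBSCBroadcast ε δ W) :
    -- the rate region is exhausted by ternary `U`, in the form with `U, V` ...
    SecretCommon.ckRegion W = SecretCommon.ckRegionOn W 3 ∧
    -- ... and in the form with `V = X`, which describes the same region
    SecretCommon.simpleRegion W = SecretCommon.simpleRegionOn W 3 ∧
    SecretCommon.ckRegion W = SecretCommon.simpleRegionOn W 3 ∧
    -- for each feasible common rate, the maximal secret rate is attained by a ternary `U`
    (∀ Rc : ℝ, (∃ Re, (Re, Rc) ∈ SecretCommon.ckRegion W) →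
      ∃ (Ω : Type) (_ : Fintype Ω) (P : Ω → ℝ) (U : Ω → Fin 3) (X Y Z : Ω → Bool),
        SecretCommon.IsAdmissible W P U X X Y Z ∧
        Rc ≤ SecretCommon.mutualInfo P U Z ∧
        IsGreatest {Re | (Re, Rc) ∈ SecretCommon.ckRegion W}
          (SecretCommon.secretBound P U X Y Z)) ∧
    -- each finite-valued `U` can be replaced by a ternary one with the same law of the input
    -- and the same values of all the information quantities involved
    (∀ (Ω : Type) (_ : Fintype Ω) (P : Ω → ℝ) (k : ℕ) (U : Ω → Fin k) (X Y Z : Ω → Bool),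
      SecretCommon.IsAdmissible W P U X X Y Z →
      ∃ (Ω' : Type) (_ : Fintype Ω') (P' : Ω' → ℝ) (U' : Ω' → Fin 3) (X' Y' Z' : Ω' → Bool),
        SecretCommon.IsAdmissible W P' U' X' X' Y' Z' ∧
        SecretCommon.law P' X' = SecretCommon.law P X ∧
        SecretCommon.mutualInfo P' U' Y' = SecretCommon.mutualInfo P U Y ∧
        SecretCommon.mutualInfo P' U' Z' = SecretCommon.mutualInfo P U Z ∧
        SecretCommon.condMutualInfo P' X' Y' U' = SecretCommon.condMutualInfo P X Y U ∧
        SecretCommon.condMutualInfo P' X' Z' U' = SecretCommon.condMutualInfo P X Z U) := by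
  have hle := hεδ.le
  have hck := SecretCommon.ckRegion_eq_simpleRegion hW hε hle hδ
  have hthree := SecretCommon.simpleRegion_eq_three hW
  refine ⟨?_, hthree, hck.trans hthree, fun Rc hRc => ?_, fun Ω _ P k U X Y Z h => ?_⟩
  · rw [hck, hthree, SecretCommon.ckRegionOn_eq_simpleRegionOn hW hε hle hδ]
  · rw [hck, hthree] at hRc ⊢
    exact SecretCommon.exists_isGreatest hW hRc
  · exact SecretCommon.exists_ternary hW h
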